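/- For $f\in\mathcal S(\mathbb R)$ let $\hat f(\xi)=\int_{\mathbb R} f(x)e^{-2\pi i x\xi}\,dx$, and let $\mathcal P(\mathbb R)$ be the set of $f\in\mathcal S(\mathbb R)$ such that $\hat f$ has compact support. A locally integrable function $m:\mathbb R^2\to\mathbb C$ is called a bilinear multiplier of type $(p_1,p_2,p_3)$ if there is a constant $C>0$ such that $$\|B_m(f,g)\|_{L^{p_3}(\mathbb R)}\le C\,\|f\|_{L^{p_1}(\mathbb R)}\,\|g\|_{L^{p_2}(\mathbb R)}\qquad\text{for all } f,g\in\mathcal P(\mathbb R),$$ where $$B_m(f,g)(x)=\int_{\mathbb R^2}\hat f(\xi)\,\hat g(\eta)\,m(\xi,\eta)\,e^{2\pi i(\xi+\eta)x}\,d\xi\,d\eta .$$ Theorem. Let $1\le p_1,p_2\le p\le 2$, let $p'$ be the conjugate exponent of $p$, that is $\frac1p+\frac1{p'}=1$, and let $p'\le p_3\le\infty$ satisfy $$\frac1{p_1}+\frac1{p_2}-\frac2p=\frac1{p_3}$$ (with $1/\infty=0$). Then every $m\in L^p(\mathbb R^2)$ is a bilinear multiplier of type $(p_1,p_2,p_3)$.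 -/

import Mathlib

open MeasureTheory
open scoped ENNReal NNReal FourierTransform SchwartzMap

noncomputable section

/-- The class `𝒫(ℝ)`: Schwartz functions whose Fourier transform
`f̂(ξ) = ∫ f(x) e^{-2πi x ξ} dx` is compactly supported. -/
def BandlimitedSchwartz : Set 𝓢(ℝ, ℂ) :=
  {f | HasCompactSupport (𝓕 (f : ℝ → ℂ))}

/-- `B_m(f,g)(x) = ∬ f̂(ξ) ĝ(η) m(ξ,η) e^{2πi(ξ+η)x} dξ dη`. The integral converges absolutely
when `m` is locally integrable and `f`, `g` are in `BandlimitedSchwartz`. -/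
def bilinearOp (m : ℝ × ℝ → ℂ) (f g : ℝ → ℂ) (x : ℝ) : ℂ :=
  ∫ z : ℝ × ℝ, 𝓕 f z.1 * 𝓕 g z.2 * m z *
    Complex.exp (2 * Real.pi * Complex.I * ((z.1 + z.2) * x : ℝ))

/-- `m` is a bilinear multiplier on `ℝ` of type `(p₁, p₂, p₃)`: it is locally integrable and
`‖B_m(f,g)‖_{p₃} ≤ C ‖f‖_{p₁} ‖g‖_{p₂}` for all `f, g` in `𝒫(ℝ)`, for some constant `C > 0`. -/
def IsBilinearMultiplier (m : ℝ × ℝ → ℂ) (p₁ p₂ p₃ : ℝ≥0∞) : Prop :=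
  LocallyIntegrable m volume ∧
    ∃ C : ℝ≥0, 0 < C ∧ ∀ f ∈ BandlimitedSchwartz, ∀ g ∈ BandlimitedSchwartz,
      eLpNorm (bilinearOp m f g) p₃ volume ≤
        C * eLpNorm (f : ℝ → ℂ) p₁ volume * eLpNorm (g : ℝ → ℂ) p₂ volume

end

/-! Expanding the two Fourier integrals and applying Fubini gives, for integrable `m`, `B_m(f,g)(x)
= ∬ f(x+u) g(x+v) K(u,v) du dv` with `K` the planar Fourier transform of `m`. Since `p ≤ 2`,
Hausdorff–Young puts `K` in `L^{p'}`, and what remains is an inequality of Young type for `|f|`,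
`|g|`, `|K|`.

For finite `p₃` that inequality follows from Hölder in `(u,v)` with weights `1/p`, `1/p₃`, `1/p' -
1/p₃`, followed by integration in `x`; for `p₃ = ∞` the exponent relation forces `p₁ = p₂ = p`, and
plain Hölder suffices.

A general `m ∈ L^p` need not be integrable, but for band-limited `f`, `g` it may be cut off to a
compact set. This does not increase its `L^p` norm, so the constant is independent of `f` and `g`.
-/

/-! ### Plancherel and Hausdorff–Young. -/

section FourierLp

open Set Filter

variable {E : Type*} [NormedAddCommGroup E] [InnerProductSpace ℝ E] [FiniteDimensional ℝ E]
  [MeasurableSpace E] [BorelSpace E]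

/-- The Fourier transform of an integrable function is continuous. -/
theorem continuous_fourier_of_integrable {f : E → ℂ} (hf : Integrable f) : Continuous (𝓕 f) :=
  VectorFourier.fourierIntegral_continuous Real.continuous_fourierChar
    (innerSL ℝ).continuous₂ hf

theorem enorm_fourier_le_lintegral (f : E → ℂ) (w : E) : ‖𝓕 f w‖ₑ ≤ ∫⁻ x, ‖f x‖ₑ := by
  rw [Real.fourier_eq]
  refine (enorm_integral_le_lintegral_enorm _).trans (le_of_eq ?_)
  refine lintegral_congr fun x => ?_
  rw [← ofReal_norm, Circle.norm_smul, ofReal_norm]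

/-- On `L¹ ∩ L²` the Fourier integral agrees with the `L²` Fourier transform. -/
theorem fourier_toLp_two_ae_eq {f : E → ℂ} (hf : Integrable f) (hf2 : MemLp f 2) :
    (𝓕 (hf2.toLp f) : Lp (α := E) ℂ 2 volume) =ᵐ[volume] 𝓕 f := by
  -- Both sides have the same pairing with test functions: the transform moves onto `G` by duality
  -- of tempered distributions on one side and by Fubini on the other.
  refine ae_eq_of_integral_contDiff_smul_eq
    ((Lp.memLp _).locallyIntegrable (by norm_num))
    (continuous_fourier_of_integrable hf).locallyIntegrable fun g hg hgs => ?_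
  have hgs' : HasCompactSupport (fun x => (g x : ℂ)) := hgs.comp_left Complex.ofReal_zero
  let G : 𝓢(E, ℂ) := hgs'.toSchwartzMap (Complex.ofRealCLM.contDiff.comp hg)
  have hG : ∀ x, G x = (g x : ℂ) := fun x => rfl
  have key := DFunLike.congr_fun (Lp.fourier_toTemperedDistribution_eq (hf2.toLp f)) G
  rw [TemperedDistribution.fourier_apply, Lp.toTemperedDistribution_apply,
    Lp.toTemperedDistribution_apply] at key
  have hflip : ∫ x, (𝓕 (G : E → ℂ)) x • f x = ∫ x, G x • 𝓕 f x := by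
    simpa using! (VectorFourier.integral_fourierIntegral_smul_eq_flip (L := innerₗ E)
      Real.continuous_fourierChar continuous_inner G.integrable hf)
  calc ∫ x, g x • (𝓕 (hf2.toLp f) : Lp (α := E) ℂ 2 volume) x
      = ∫ x, G x • (𝓕 (hf2.toLp f) : Lp (α := E) ℂ 2 volume) x := by simp [hG]
    _ = ∫ x, (𝓕 G) x • (hf2.toLp f) x := key.symm
    _ = ∫ x, (𝓕 (G : E → ℂ)) x • f x := by
        refine integral_congr_ae ?_
        filter_upwards [hf2.coeFn_toLp] with x hx
        rw [hx, SchwartzMap.fourier_coe]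
    _ = ∫ x, G x • 𝓕 f x := hflip
    _ = ∫ x, g x • 𝓕 f x := by simp [hG]

theorem eLpNorm_fourier_two_le {f : E → ℂ} (hf : Integrable f) :
    eLpNorm (𝓕 f) 2 volume ≤ eLpNorm f 2 volume := by
  by_cases hf2 : MemLp f 2
  · rw [← eLpNorm_congr_ae (fourier_toLp_two_ae_eq hf hf2), ← eLpNorm_congr_ae hf2.coeFn_toLp,
      ← Lp.enorm_def, ← Lp.enorm_def, ← ofReal_norm, ← ofReal_norm,
      Lp.norm_fourier_eq]
  · have : eLpNorm f 2 volume = ⊤ := by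
      by_contra h
      exact hf2 ⟨hf.1, lt_top_iff_ne_top.2 h⟩
    simp [this]

theorem lintegral_fourier_sq_le {f : E → ℂ} (hf : Integrable f) :
    ∫⁻ w, ‖𝓕 f w‖ₑ ^ 2 ≤ ∫⁻ x, ‖f x‖ₑ ^ 2 := by
  have h := eLpNorm_fourier_two_le hf
  rw [eLpNorm_eq_lintegral_rpow_enorm_toReal (by norm_num) (by norm_num),
    eLpNorm_eq_lintegral_rpow_enorm_toReal (by norm_num) (by norm_num),
    ENNReal.rpow_le_rpow_iff (by norm_num)] at h
  simpa using h

/-- Distributional estimate: at height `t`, the part of `f` where `t * ‖f‖ ^ (p - 1)` exceeds `2 A`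
contributes at most `t / 2` to the Fourier transform. -/
theorem meas_lt_norm_fourier_le {f : E → ℂ} (hf : Integrable f) {p : ℝ}
    {A : ℝ} (hA : 0 < A) (hfA : ∫⁻ x, ENNReal.ofReal (‖f x‖ ^ p) ≤ ENNReal.ofReal A)
    {t : ℝ} (ht : 0 < t) :
    volume {w | t < ‖𝓕 f w‖} ≤ ENNReal.ofReal (4 / t ^ 2) *
      ∫⁻ x, {x | t * ‖f x‖ ^ (p - 1) ≤ 2 * A}.indicator (fun x => ‖f x‖ₑ ^ 2) x := by
  set S : Set E := {x | t * ‖f x‖ ^ (p - 1) ≤ 2 * A} with hS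
  have hSm : NullMeasurableSet S := by
    refine nullMeasurableSet_le ?_ aemeasurable_const
    exact (hf.1.norm.aemeasurable.pow_const _).const_mul _
  have h2 : Integrable (S.indicator f) := hf.indicator₀ hSm
  have h1 : Integrable (Sᶜ.indicator f) := hf.indicator₀ hSm.compl
  have hsplit : ∀ w, 𝓕 f w = 𝓕 (S.indicator f) w + 𝓕 (Sᶜ.indicator f) w := by
    intro w
    have := VectorFourier.fourierIntegral_add (μ := volume) (L := innerₗ E)
      Real.continuous_fourierChar continuous_inner h2 h1
    rw [indicator_self_add_compl] at this
    exact congrFun this w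
  -- Off `S`, `‖f‖ ≤ t / (2 * A) * ‖f‖ ^ p`, so the `L¹` norm there, which bounds the transform
  -- uniformly, is at most `t / 2`.
  have hbig : ∫⁻ x, ‖Sᶜ.indicator f x‖ₑ ≤ ENNReal.ofReal (t / 2) := by
    calc ∫⁻ x, ‖Sᶜ.indicator f x‖ₑ
        ≤ ∫⁻ x, ENNReal.ofReal (t / (2 * A)) * ENNReal.ofReal (‖f x‖ ^ p) := by
          refine lintegral_mono fun x => ?_
          by_cases hx : x ∈ S
          · simp [hx]
          · rw [indicator_of_mem (by simpa using hx), ← ofReal_norm,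
              ← ENNReal.ofReal_mul (by positivity)]
            refine ENNReal.ofReal_le_ofReal ?_
            simp only [hS, mem_ofPred_eq, not_le] at hx
            rcases eq_or_ne (f x) 0 with h0 | h0
            · rw [h0]; simp; positivity
            have hpos : 0 < ‖f x‖ := norm_pos_iff.2 h0
            have : ‖f x‖ ^ p = ‖f x‖ ^ (p - 1) * ‖f x‖ := by
              rw [← Real.rpow_add_one hpos.ne', sub_add_cancel]
            rw [this, div_mul_eq_mul_div, le_div_iff₀ (by positivity)]
            nlinarith
      _ ≤ ENNReal.ofReal (t / (2 * A)) * ENNReal.ofReal A := by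
          rw [lintegral_const_mul' _ _ ENNReal.ofReal_ne_top]
          gcongr
      _ = ENNReal.ofReal (t / 2) := by
          rw [← ENNReal.ofReal_mul (by positivity)]
          congr 1
          field_simp
  -- The part of `f` on `S` must supply the other `t / 2`; Chebyshev and the `L²` bound then give
  -- the factor `4 / t ^ 2`.
  have hsub : {w | t < ‖𝓕 f w‖} ⊆
      {w | ENNReal.ofReal ((t / 2) ^ 2) ≤ ‖𝓕 (S.indicator f) w‖ₑ ^ 2} := by
    intro w hw
    have hb := (enorm_fourier_le_lintegral (Sᶜ.indicator f) w).trans hbig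
    rw [← ofReal_norm, ENNReal.ofReal_le_ofReal_iff (by positivity)] at hb
    have hw' : t < ‖𝓕 f w‖ := hw
    rw [hsplit w] at hw'
    have htri := norm_add_le (𝓕 (S.indicator f) w) (𝓕 (Sᶜ.indicator f) w)
    rw [mem_ofPred_eq, ← ofReal_norm, ← ENNReal.ofReal_pow (norm_nonneg _)]
    refine ENNReal.ofReal_le_ofReal ?_
    gcongr
    linarith
  have hcheb := mul_meas_ge_le_lintegral₀ (μ := volume)
    ((continuous_fourier_of_integrable h2).aemeasurable.enorm.pow_const 2)
    (ENNReal.ofReal ((t / 2) ^ 2))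
  have hone : ENNReal.ofReal (4 / t ^ 2) * ENNReal.ofReal ((t / 2) ^ 2) = 1 := by
    rw [← ENNReal.ofReal_mul (by positivity), ← ENNReal.ofReal_one]
    congr 1
    field_simp
    norm_num
  calc volume {w | t < ‖𝓕 f w‖}
      ≤ volume {w | ENNReal.ofReal ((t / 2) ^ 2) ≤ ‖𝓕 (S.indicator f) w‖ₑ ^ 2} :=
        measure_mono hsub
    _ = ENNReal.ofReal (4 / t ^ 2) * (ENNReal.ofReal ((t / 2) ^ 2) *
          volume {w | ENNReal.ofReal ((t / 2) ^ 2) ≤ ‖𝓕 (S.indicator f) w‖ₑ ^ 2}) := by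
        rw [← mul_assoc, hone, one_mul]
    _ ≤ ENNReal.ofReal (4 / t ^ 2) * ∫⁻ x, ‖S.indicator f x‖ₑ ^ 2 := by
        gcongr
        exact hcheb.trans (lintegral_fourier_sq_le h2)
    _ = _ := by
        congr 1
        refine lintegral_congr fun x => ?_
        by_cases hx : x ∈ S <;> simp [hx]

/-- The inner integral of the layer-cake formula after Tonelli, used with `s = q - 2`; convergence
at `0` is where `q > 2` enters. -/
theorem lintegral_Ioi_indicator_rpow {a b s : ℝ} (ha : 0 < a) (hb : 0 < b) (hs : 0 < s) :
    ∫⁻ t in Ioi (0 : ℝ), {t : ℝ | t * a ≤ b}.indicator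
      (fun t => ENNReal.ofReal (t ^ (s - 1))) t = ENNReal.ofReal ((b / a) ^ s / s) := by
  have hset : {t : ℝ | t * a ≤ b} = Iic (b / a) := by
    ext t; simp [le_div_iff₀ ha]
  rw [hset, lintegral_indicator measurableSet_Iic, Measure.restrict_restrict measurableSet_Iic,
    inter_comm, Ioi_inter_Iic]
  have hba : 0 ≤ b / a := by positivity
  have hint : IntervalIntegrable (fun t : ℝ => t ^ (s - 1)) volume 0 (b / a) :=
    intervalIntegral.intervalIntegrable_rpow' (by linarith)
  rw [← ofReal_integral_eq_lintegral_ofReal, ← intervalIntegral.integral_of_le hba,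
    integral_rpow (Or.inl (by linarith))]
  · simp [Real.zero_rpow hs.ne']
  · exact (intervalIntegrable_iff_integrableOn_Ioc_of_le hba).1 hint
  · filter_upwards [ae_restrict_mem measurableSet_Ioc] with t ht
    exact Real.rpow_nonneg ht.1.le _

/-- **Hausdorff–Young inequality** (with a non-sharp constant), in integral form. -/
theorem lintegral_fourier_rpow_le {f : E → ℂ} (hf : Integrable f) {p q : ℝ}
    (hpq : p.HolderConjugate q) (hq : 2 < q)
    {A : ℝ} (hA : 0 < A) (hfA : ∫⁻ x, ENNReal.ofReal (‖f x‖ ^ p) ≤ ENNReal.ofReal A) :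
    ∫⁻ w, ENNReal.ofReal (‖𝓕 f w‖ ^ q) ≤
      ENNReal.ofReal (q * 4 * 2 ^ (q - 2) / (q - 2) * A ^ (q - 1)) := by
  have hq2 : 0 < q - 2 := by linarith
  -- A strongly measurable representative supplies the joint measurability needed for Tonelli.
  obtain ⟨f₀, hf₀m, hff₀⟩ := hf.1
  have hf₀i : Integrable f₀ := hf.congr hff₀
  have hfour : 𝓕 f = 𝓕 f₀ := funext fun w => Real.fourier_congr_ae hff₀ w
  have hfA' : ∫⁻ x, ENNReal.ofReal (‖f₀ x‖ ^ p) ≤ ENNReal.ofReal A := by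
    refine (le_of_eq (lintegral_congr_ae ?_)).trans hfA
    filter_upwards [hff₀] with x hx
    rw [hx]
  rw [hfour, lintegral_rpow_eq_lintegral_meas_lt_mul volume (ae_of_all _ fun w => norm_nonneg _)
    (continuous_fourier_of_integrable hf₀i).norm.aemeasurable (by linarith)]
  have hmeas : Measurable fun x => ‖f₀ x‖ := hf₀m.norm.measurable
  -- This identity makes the threshold `t * ‖f‖ ^ (p - 1) ≤ 2 * A` the right one: integrating in `t`
  -- turns `‖f‖ ^ 2` into a multiple of `‖f‖ ^ p`.
  have hexp : (p - 1) * (q - 2) = 2 - p := by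
    have := hpq.mul_eq_add
    linarith
  have distribution_le : ∫⁻ t in Ioi (0 : ℝ), volume {w | t < ‖𝓕 f₀ w‖} * ENNReal.ofReal (t ^ (q - 1)) ≤
      ∫⁻ t in Ioi (0 : ℝ), ∫⁻ x, ENNReal.ofReal 4 * (‖f₀ x‖ₑ ^ 2 *
        {t : ℝ | t * ‖f₀ x‖ ^ (p - 1) ≤ 2 * A}.indicator
          (fun t => ENNReal.ofReal (t ^ (q - 2 - 1))) t) := by
    refine setLIntegral_mono' measurableSet_Ioi fun t ht => ?_
    have ht : 0 < t := ht
    refine (mul_le_mul_left (meas_lt_norm_fourier_le hf₀i hA hfA' ht) _).trans (le_of_eq ?_)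
    rw [mul_right_comm, ← lintegral_const_mul']
    swap
    · exact ENNReal.mul_ne_top ENNReal.ofReal_ne_top ENNReal.ofReal_ne_top
    refine lintegral_congr fun x => ?_
    by_cases hx : t * ‖f₀ x‖ ^ (p - 1) ≤ 2 * A
    · rw [indicator_of_mem (by exact hx), indicator_of_mem (by exact hx),
        ← ENNReal.ofReal_mul (by positivity), mul_comm (‖f₀ x‖ₑ ^ 2), ← mul_assoc,
        ← ENNReal.ofReal_mul (by positivity)]
      congr 2
      have : t ^ (q - 1) = t ^ (q - 2 - 1) * t ^ 2 := by
        rw [← Real.rpow_natCast, ← Real.rpow_add ht]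
        congr 1
        push_cast
        ring
      rw [this]
      field_simp
    · rw [indicator_of_notMem (by exact hx), indicator_of_notMem (by exact hx)]
      simp
  have hjoint : Measurable fun z : ℝ × E => ENNReal.ofReal 4 * (‖f₀ z.2‖ₑ ^ 2 *
      {t : ℝ | t * ‖f₀ z.2‖ ^ (p - 1) ≤ 2 * A}.indicator
        (fun t => ENNReal.ofReal (t ^ (q - 2 - 1))) z.1) := by
    refine Measurable.const_mul (Measurable.mul ?_ ?_) _
    · exact (hf₀m.measurable.comp measurable_snd).enorm.pow_const 2
    · have : Measurable ({z : ℝ × E | z.1 * ‖f₀ z.2‖ ^ (p - 1) ≤ 2 * A}.indicator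
          fun z => ENNReal.ofReal (z.1 ^ (q - 2 - 1))) := by
        refine Measurable.indicator ?_ (measurableSet_le ?_ measurable_const)
        · exact (measurable_fst.pow_const _).ennreal_ofReal
        · exact measurable_fst.mul ((hmeas.comp measurable_snd).pow_const _)
      exact this
  have tonelli_le : ∫⁻ t in Ioi (0 : ℝ), ∫⁻ x, ENNReal.ofReal 4 * (‖f₀ x‖ₑ ^ 2 *
        {t : ℝ | t * ‖f₀ x‖ ^ (p - 1) ≤ 2 * A}.indicator
          (fun t => ENNReal.ofReal (t ^ (q - 2 - 1))) t) ≤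
      ∫⁻ x, ENNReal.ofReal (4 * (2 * A) ^ (q - 2) / (q - 2)) * ENNReal.ofReal (‖f₀ x‖ ^ p) := by
    rw [lintegral_lintegral_swap hjoint.aemeasurable]
    refine lintegral_mono fun x => ?_
    rw [lintegral_const_mul' _ _ ENNReal.ofReal_ne_top,
      lintegral_const_mul' _ _ (by simp)]
    rcases eq_or_ne (f₀ x) 0 with h0 | h0
    · simp [h0]
    have hpos : 0 < ‖f₀ x‖ := norm_pos_iff.2 h0
    rw [lintegral_Ioi_indicator_rpow (Real.rpow_pos_of_pos hpos _) (by positivity) hq2,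
      ← ofReal_norm, ← ENNReal.ofReal_pow (norm_nonneg _),
      ← ENNReal.ofReal_mul (by positivity), ← ENNReal.ofReal_mul (by positivity),
      ← ENNReal.ofReal_mul (by positivity)]
    refine ENNReal.ofReal_le_ofReal (le_of_eq ?_)
    rw [Real.div_rpow (by positivity) (by positivity), ← Real.rpow_mul hpos.le, hexp]
    have : ‖f₀ x‖ ^ 2 = ‖f₀ x‖ ^ p * ‖f₀ x‖ ^ (2 - p) := by
      rw [← Real.rpow_add hpos, ← Real.rpow_natCast]
      congr 1
      push_cast
      ring
    rw [this]
    have h3 : 0 < ‖f₀ x‖ ^ (2 - p) := Real.rpow_pos_of_pos hpos _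
    field_simp
  calc _ ≤ ENNReal.ofReal q * (ENNReal.ofReal (4 * (2 * A) ^ (q - 2) / (q - 2)) *
        ENNReal.ofReal A) := by
        gcongr
        refine (distribution_le.trans tonelli_le).trans ?_
        rw [lintegral_const_mul' _ _ ENNReal.ofReal_ne_top]
        gcongr
    _ = _ := by
        rw [← ENNReal.ofReal_mul (by positivity), ← ENNReal.ofReal_mul (by linarith)]
        congr 1
        rw [Real.mul_rpow (by norm_num) hA.le]
        have : A ^ (q - 1) = A ^ (q - 2) * A := by
          rw [← Real.rpow_add_one hA.ne']
          congr 1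
          ring
        rw [this]
        ring

/-- **Hausdorff–Young inequality** (with a non-sharp constant) for integrable functions. -/
theorem exists_eLpNorm_fourier_le {p q : ℝ≥0∞} (hpq : p.HolderConjugate q) (hp : p ≤ 2) :
    ∃ C : ℝ≥0, ∀ f : E → ℂ, Integrable f → MemLp f p →
      eLpNorm (𝓕 f) q volume ≤ C * eLpNorm f p volume := by
  have h1p : 1 ≤ p := hpq.one_le
  rcases h1p.eq_or_lt with rfl | h1p
  · obtain rfl : q = ⊤ := ENNReal.HolderConjugate.unique 1 q ⊤
    refine ⟨1, fun f _ _ => ?_⟩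
    rw [eLpNorm_exponent_top, eLpNorm_one_eq_lintegral_enorm, ENNReal.coe_one, one_mul]
    exact eLpNormEssSup_le_of_ae_enorm_bound (ae_of_all _ (enorm_fourier_le_lintegral f))
  -- The interpolation constant blows up as `q → 2`, so this endpoint uses Plancherel.
  rcases hp.eq_or_lt with rfl | hp2
  · obtain rfl : q = 2 := ENNReal.HolderConjugate.unique 2 q 2
    refine ⟨1, fun f hf _ => ?_⟩
    simpa using eLpNorm_fourier_two_le hf
  have hptop : p ≠ ⊤ := (hp2.trans ENNReal.ofNat_lt_top).ne
  have hp0 : p ≠ 0 := (zero_lt_one.trans h1p).ne'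
  have hqtop : q ≠ ⊤ := by
    rintro rfl
    exact h1p.ne' (ENNReal.HolderConjugate.unique ⊤ p 1)
  have hq0 : q ≠ 0 := (zero_lt_one.trans_le hpq.symm.one_le).ne'
  have hpqr : p.toReal.HolderConjugate q.toReal := 
    ENNReal.HolderConjugate.toReal_of_ne_top hptop hqtop
  have hpr2 : p.toReal < 2 := by
    simpa using (ENNReal.toReal_lt_toReal hptop (by simp)).2 hp2
  have hq2 : 2 < q.toReal := by
    have h1 := hpqr.mul_eq_add
    have h2 := hpqr.lt
    have h3 := hpqr.symm.lt
    nlinarith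
  set P := p.toReal
  set Q := q.toReal
  set c : ℝ := Q * 4 * 2 ^ (Q - 2) / (Q - 2) with hc
  have hcnn : 0 ≤ c := by
    have : 0 < Q - 2 := by linarith
    positivity
  refine ⟨(c ^ (1 / Q)).toNNReal, fun f hf hfp => ?_⟩
  by_cases h0 : eLpNorm f p volume = 0
  · have hf0 : f =ᵐ[volume] 0 := (eLpNorm_eq_zero_iff hf.1 hp0).1 h0
    have : 𝓕 f = 0 := by
      funext w
      rw [Real.fourier_congr_ae hf0 w, Real.fourier_eq]
      simp
    simp [this]
  set N := (eLpNorm f p volume).toReal with hN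
  have hNpos : 0 < N := ENNReal.toReal_pos h0 hfp.2.ne
  have hNe : eLpNorm f p volume = ENNReal.ofReal N := (ENNReal.ofReal_toReal hfp.2.ne).symm
  have hPpos : 0 < P := hpqr.pos
  have hQpos : 0 < Q := hpqr.symm.pos
  have hfA : ∫⁻ x, ENNReal.ofReal (‖f x‖ ^ P) ≤ ENNReal.ofReal (N ^ P) := by
    rw [← ENNReal.ofReal_rpow_of_pos hNpos, ← hNe,
      eLpNorm_eq_lintegral_rpow_enorm_toReal hp0 hptop, ← ENNReal.rpow_mul,
      one_div_mul_cancel hPpos.ne', ENNReal.rpow_one]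
    refine le_of_eq (lintegral_congr fun x => ?_)
    rw [← ENNReal.ofReal_rpow_of_nonneg (norm_nonneg _) hPpos.le, ofReal_norm]
  have key := lintegral_fourier_rpow_le hf hpqr hq2 (Real.rpow_pos_of_pos hNpos P) hfA
  rw [← hc] at key
  rw [eLpNorm_eq_lintegral_rpow_enorm_toReal hq0 hqtop, hNe]
  calc (∫⁻ w, ‖𝓕 f w‖ₑ ^ Q) ^ (1 / Q)
      = (∫⁻ w, ENNReal.ofReal (‖𝓕 f w‖ ^ Q)) ^ (1 / Q) := by
        congr 1
        refine lintegral_congr fun x => ?_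
        rw [← ENNReal.ofReal_rpow_of_nonneg (norm_nonneg _) hQpos.le, ofReal_norm]
    _ ≤ (ENNReal.ofReal (c * (N ^ P) ^ (Q - 1))) ^ (1 / Q) := by gcongr
    _ = ENNReal.ofReal (c ^ (1 / Q)) * ENNReal.ofReal N := by
        rw [ENNReal.ofReal_rpow_of_nonneg (by positivity) (by positivity),
          ← ENNReal.ofReal_mul (by positivity), Real.mul_rpow hcnn (by positivity),
          ← Real.rpow_mul hNpos.le, ← Real.rpow_mul hNpos.le]
        -- With `A = N ^ P`, conjugacy makes the bound homogeneous of degree one in `N`.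
        have : P * (Q - 1) * (1 / Q) = 1 := by
          have := hpqr.mul_eq_add
          field_simp
          linarith
        rw [this, Real.rpow_one]

end FourierLp

/-! ### A bilinear Young inequality. -/

section BilinearYoung

/-- Three-factor Hölder inequality for lower integrals. -/
theorem lintegral_mul_mul_rpow_le {α : Type*} [MeasurableSpace α] {μ : Measure α}
    {f g h : α → ℝ≥0∞} (hf : AEMeasurable f μ) (hg : AEMeasurable g μ) (hh : AEMeasurable h μ)
    {a b c : ℝ} (ha : 0 ≤ a) (hb : 0 ≤ b) (hc : 0 ≤ c) (habc : a + b + c = 1) :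
    ∫⁻ x, f x ^ a * g x ^ b * h x ^ c ∂μ ≤
      (∫⁻ x, f x ∂μ) ^ a * (∫⁻ x, g x ∂μ) ^ b * (∫⁻ x, h x ∂μ) ^ c := by
  have := ENNReal.lintegral_prod_norm_pow_le (μ := μ) Finset.univ (f := ![f, g, h])
    (p := ![a, b, c]) (by intro i _; fin_cases i <;> assumption)
    (by simpa [Fin.sum_univ_three] using habc) (by intro i _; fin_cases i <;> assumption)
  simpa [Fin.prod_univ_three] using this

/-- A Young-type inequality for the bilinear averages
`x ↦ ∬ F (x + u) ^ a * G (x + v) ^ b * H (u, v) ^ (1 / q)`. -/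
theorem lintegral_bilinear_average_rpow_le {F G : ℝ → ℝ≥0∞} {H : ℝ × ℝ → ℝ≥0∞}
    (hF : Measurable F) (hG : Measurable G) (hH : Measurable H)
    {p q r α β : ℝ} (hpq : p.HolderConjugate q) (hqr : q ≤ r) (hα : 0 ≤ α) (hβ : 0 ≤ β)
    (hαβ : α + β = 1 / r) :
    ∫⁻ x, (∫⁻ z : ℝ × ℝ, F (x + z.1) ^ (1 / p + α) * G (x + z.2) ^ (1 / p + β) *
        H z ^ (1 / q)) ^ r ≤
      ((∫⁻ x, F x) ^ (1 / p + α) * (∫⁻ x, G x) ^ (1 / p + β) * (∫⁻ z, H z) ^ (1 / q)) ^ r := by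
  have hp0 : 0 < p := hpq.pos
  have hq0 : 0 < q := hpq.symm.pos
  have hr0 : 0 < r := hq0.trans_le hqr
  have hinv : p⁻¹ + q⁻¹ = 1 := hpq.inv_add_inv_eq_one
  have hp1 : 0 ≤ 1 / p := by positivity
  have hqr1 : 0 ≤ 1 / q - 1 / r := sub_nonneg.2 (one_div_le_one_div_of_le hq0 hqr)
  have hr1 : 0 ≤ 1 / r := by positivity
  have hFx : ∀ x, Measurable fun z : ℝ × ℝ => F (x + z.1) := fun x =>
    hF.comp (measurable_fst.const_add x)
  have hGx : ∀ x, Measurable fun z : ℝ × ℝ => G (x + z.2) := fun x =>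
    hG.comp (measurable_snd.const_add x)
  set IF := ∫⁻ x, F x
  set IG := ∫⁻ x, G x
  set IH := ∫⁻ z, H z
  let T : ℝ → ℝ × ℝ → ℝ≥0∞ := fun x z => F (x + z.1) ^ (α * r) * G (x + z.2) ^ (β * r) * H z
  have hTm : Measurable (Function.uncurry T) := by
    refine Measurable.mul (Measurable.mul ?_ ?_) (hH.comp measurable_snd)
    · exact (hF.comp (measurable_fst.add measurable_snd.fst)).pow_const _
    · exact (hG.comp (measurable_fst.add measurable_snd.snd)).pow_const _
  -- Hölder with weights `1/p`, `1/r`, `1/q - 1/r`; by translation invariance only the factor with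
  -- `T` depends on `x`.
  have pointwise : ∀ x, ∫⁻ z : ℝ × ℝ, F (x + z.1) ^ (1 / p + α) * G (x + z.2) ^ (1 / p + β) *
        H z ^ (1 / q) ≤ (IF * IG) ^ (1 / p) * (∫⁻ z, T x z) ^ (1 / r) * IH ^ (1 / q - 1 / r) := by
    intro x
    have hFG : ∫⁻ z : ℝ × ℝ, F (x + z.1) * G (x + z.2) = IF * IG := by
      rw [Measure.volume_eq_prod, lintegral_prod_mul (f := fun u => F (x + u))
        (g := fun v => G (x + v)) (hF.comp (measurable_const_add x)).aemeasurable
        (hG.comp (measurable_const_add x)).aemeasurable, lintegral_add_left_eq_self,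
        lintegral_add_left_eq_self]
    rw [← hFG]
    refine le_trans (le_of_eq (lintegral_congr fun z => ?_))
      (lintegral_mul_mul_rpow_le ((hFx x).mul (hGx x)).aemeasurable
        (hTm.comp measurable_prodMk_left).aemeasurable hH.aemeasurable hp1 hr1 hqr1 ?_)
    · simp only [T, Function.comp_apply, Function.uncurry_apply_pair, Pi.mul_apply]
      rw [ENNReal.mul_rpow_of_nonneg _ _ hp1, ENNReal.mul_rpow_of_nonneg _ _ hr1,
        ENNReal.mul_rpow_of_nonneg _ _ hr1, ← ENNReal.rpow_mul, ← ENNReal.rpow_mul,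
        mul_assoc α, mul_assoc β, mul_one_div_cancel hr0.ne', mul_one, mul_one,
        ENNReal.rpow_add_of_nonneg _ _ hp1 hα, ENNReal.rpow_add_of_nonneg _ _ hp1 hβ]
      have : H z ^ (1 / q) = H z ^ (1 / r) * H z ^ (1 / q - 1 / r) := by
        rw [← ENNReal.rpow_add_of_nonneg _ _ hr1 hqr1, add_sub_cancel]
      rw [this]
      ring
    · simp only [one_div]
      linarith
  -- For fixed `z`, Hölder in `x` applies because `α * r + β * r = 1`.
  have total : ∫⁻ x, ∫⁻ z, T x z ≤ IF ^ (α * r) * IG ^ (β * r) * IH := by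
    rw [lintegral_lintegral_swap hTm.aemeasurable, ← lintegral_const_mul _ hH]
    refine lintegral_mono fun z => ?_
    have hm1 : Measurable fun x => F (x + z.1) := hF.comp (measurable_add_const _)
    have hm2 : Measurable fun x => G (x + z.2) := hG.comp (measurable_add_const _)
    have hm12 : Measurable fun x => F (x + z.1) ^ (α * r) * G (x + z.2) ^ (β * r) :=
      (hm1.pow_const _).mul (hm2.pow_const _)
    simp only [T]
    rw [lintegral_mul_const _ hm12]
    gcongr
    refine (ENNReal.lintegral_mul_norm_pow_le hm1.aemeasurable hm2.aemeasurable
      (by positivity) (by positivity) ?_).trans ?_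
    · rw [← add_mul, hαβ, one_div_mul_cancel hr0.ne']
    · rw [lintegral_add_right_eq_self, lintegral_add_right_eq_self]
  calc _ ≤ ∫⁻ x, ((IF * IG) ^ (1 / p) * IH ^ (1 / q - 1 / r)) ^ r * ∫⁻ z, T x z := by
        refine lintegral_mono fun x => ?_
        refine (ENNReal.rpow_le_rpow (pointwise x) hr0.le).trans (le_of_eq ?_)
        rw [mul_right_comm, ENNReal.mul_rpow_of_nonneg _ _ hr0.le, ← ENNReal.rpow_mul (∫⁻ z, T x z),
          one_div_mul_cancel hr0.ne', ENNReal.rpow_one]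
    _ ≤ ((IF * IG) ^ (1 / p) * IH ^ (1 / q - 1 / r)) ^ r * (IF ^ (α * r) * IG ^ (β * r) * IH) := by
        have hIT : Measurable fun x => ∫⁻ z, T x z := hTm.lintegral_prod_right'
        rw [lintegral_const_mul _ hIT]
        gcongr
    _ = _ := by
        rw [ENNReal.rpow_mul, ENNReal.rpow_mul, ENNReal.rpow_add_of_nonneg _ _ hp1 hα,
          ENNReal.rpow_add_of_nonneg _ _ hp1 hβ]
        have h1 : IH ^ (1 / q) = IH ^ (1 / q - 1 / r) * IH ^ (1 / r) := by
          rw [← ENNReal.rpow_add_of_nonneg _ _ hqr1 hr1, sub_add_cancel]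
        have h2 : IH = (IH ^ (1 / r)) ^ r := by
          rw [← ENNReal.rpow_mul, one_div_mul_cancel hr0.ne', ENNReal.rpow_one]
        rw [h1]
        nth_rewrite 2 [h2]
        simp only [← ENNReal.mul_rpow_of_nonneg _ _ hr0.le]
        congr 1
        rw [ENNReal.mul_rpow_of_nonneg _ _ hp1]
        ring

end BilinearYoung

/-! ### Kernel representation of the bilinear operator. -/

section Kernel

/-- The kernel of a bilinear multiplier operator: the Fourier transform of the symbol on the
Euclidean plane. -/
noncomputable def multiplierKernel (m : ℝ × ℝ → ℂ) (z : ℝ × ℝ) : ℂ :=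
  𝓕 (fun y : WithLp 2 (ℝ × ℝ) => m y.ofLp) (WithLp.toLp 2 z)

theorem integrable_comp_ofLp {m : ℝ × ℝ → ℂ} (hm : Integrable m) :
    Integrable fun y : WithLp 2 (ℝ × ℝ) => m y.ofLp :=
  (WithLp.volume_preserving_ofLp ℝ ℝ).integrable_comp_of_integrable hm

theorem multiplierKernel_eq_integral (m : ℝ × ℝ → ℂ) (z : ℝ × ℝ) :
    multiplierKernel m z = ∫ y : ℝ × ℝ,
      Complex.exp ((-2 * Real.pi * (y.1 * z.1 + y.2 * z.2) : ℝ) * Complex.I) * m y := by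
  rw [multiplierKernel, Real.fourier_eq',
    ← (WithLp.volume_preserving_ofLp ℝ ℝ).integral_comp
      (MeasurableEquiv.toLp 2 (ℝ × ℝ)).symm.measurableEmbedding]
  refine integral_congr_ae (ae_of_all _ fun y => ?_)
  simp only [smul_eq_mul, WithLp.prod_inner_apply]
  congr 4
  simp [mul_comm]

theorem continuous_multiplierKernel {m : ℝ × ℝ → ℂ} (hm : Integrable m) :
    Continuous (multiplierKernel m) :=
  (continuous_fourier_of_integrable (integrable_comp_ofLp hm)).comp
    (WithLp.prod_continuous_toLp 2 ℝ ℝ)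

/-- Hausdorff–Young on the Euclidean plane, transported along the measure-preserving identification
with `ℝ × ℝ`, whose own norm is the sup norm. -/
theorem exists_eLpNorm_multiplierKernel_le {p q : ℝ≥0∞} (hpq : p.HolderConjugate q)
    (hp : p ≤ 2) :
    ∃ C : ℝ≥0, ∀ m : ℝ × ℝ → ℂ, Integrable m → MemLp m p →
      eLpNorm (multiplierKernel m) q volume ≤ C * eLpNorm m p volume := by
  obtain ⟨C, hC⟩ := exists_eLpNorm_fourier_le (E := WithLp 2 (ℝ × ℝ)) hpq hp
  refine ⟨C, fun m hm hmp => ?_⟩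
  have h := hC _ (integrable_comp_ofLp hm)
    (hmp.comp_measurePreserving (WithLp.volume_preserving_ofLp ℝ ℝ))
  have h1 := eLpNorm_comp_measurePreserving (p := p) hm.1 (WithLp.volume_preserving_ofLp ℝ ℝ)
  have h2 := eLpNorm_comp_measurePreserving (p := q)
    (continuous_fourier_of_integrable (integrable_comp_ofLp hm)).aestronglyMeasurable
    (WithLp.volume_preserving_toLp ℝ ℝ)
  exact (h2.le.trans h).trans (by gcongr; exact h1.le)

/-- Modulating the transform translates the function: substitute `x + u` in the Fourier integral. -/
theorem fourier_mul_exp_eq_integral (f : ℝ → ℂ) (ξ x : ℝ) :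
    𝓕 f ξ * Complex.exp (2 * Real.pi * Complex.I * (ξ * x : ℝ)) =
      ∫ u, Complex.exp ((-2 * Real.pi * (ξ * u) : ℝ) * Complex.I) * f (x + u) := by
  rw [Real.fourier_real_eq_integral_exp_smul, ← integral_mul_const,
    ← integral_add_left_eq_self _ x]
  refine integral_congr_ae (ae_of_all _ fun u => ?_)
  simp only [smul_eq_mul]
  rw [mul_right_comm, ← Complex.exp_add]
  congr 2
  push_cast
  ring

/-- Kernel representation of the bilinear operator with an integrable symbol. -/
theorem bilinearOp_eq_integral_kernel {m : ℝ × ℝ → ℂ} {f g : ℝ → ℂ} (hm : Integrable m)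
    (hf : Integrable f) (hg : Integrable g) (x : ℝ) :
    bilinearOp m f g x = ∫ z : ℝ × ℝ, f (x + z.1) * g (x + z.2) * multiplierKernel m z := by
  let e : ℝ × ℝ → ℝ × ℝ → ℂ := fun y z =>
    Complex.exp ((-2 * Real.pi * (y.1 * z.1 + y.2 * z.2) : ℝ) * Complex.I)
  have hfg : Integrable fun z : ℝ × ℝ => f (x + z.1) * g (x + z.2) :=
    (hf.comp_add_left x).mul_prod (hg.comp_add_left x)
  have hint : Integrable (Function.uncurry fun y z : ℝ × ℝ =>
      e y z * (m y * (f (x + z.1) * g (x + z.2)))) (volume.prod volume) := by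
    refine (hm.mul_prod hfg).bdd_mul (c := 1) ?_ (ae_of_all _ fun w => ?_)
    · refine Continuous.aestronglyMeasurable ?_
      fun_prop
    · exact (Complex.norm_exp_ofReal_mul_I _).le
  calc bilinearOp m f g x
      = ∫ y : ℝ × ℝ, ∫ z : ℝ × ℝ, e y z * (m y * (f (x + z.1) * g (x + z.2))) := by
        refine integral_congr_ae (ae_of_all _ fun y => ?_)
        have hsplit : 𝓕 f y.1 * 𝓕 g y.2 * m y *
            Complex.exp (2 * Real.pi * Complex.I * ((y.1 + y.2) * x : ℝ)) =
            m y * ((𝓕 f y.1 * Complex.exp (2 * Real.pi * Complex.I * (y.1 * x : ℝ))) *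
              (𝓕 g y.2 * Complex.exp (2 * Real.pi * Complex.I * (y.2 * x : ℝ)))) := by
          have : Complex.exp (2 * Real.pi * Complex.I * ((y.1 + y.2) * x : ℝ)) =
              Complex.exp (2 * Real.pi * Complex.I * (y.1 * x : ℝ)) *
                Complex.exp (2 * Real.pi * Complex.I * (y.2 * x : ℝ)) := by
            rw [← Complex.exp_add]
            congr 1
            push_cast
            ring
          rw [this]
          ring
        simp only [hsplit]
        rw [fourier_mul_exp_eq_integral, fourier_mul_exp_eq_integral, ← integral_prod_mul,
          ← integral_const_mul]
        refine integral_congr_ae (ae_of_all _ fun z => ?_)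
        have : e y z = Complex.exp ((-2 * Real.pi * (y.1 * z.1) : ℝ) * Complex.I) *
            Complex.exp ((-2 * Real.pi * (y.2 * z.2) : ℝ) * Complex.I) := by
          rw [← Complex.exp_add]
          simp only [e]
          congr 1
          push_cast
          ring
        simp only [this]
        ring
    _ = ∫ z : ℝ × ℝ, ∫ y : ℝ × ℝ, e y z * (m y * (f (x + z.1) * g (x + z.2))) :=
        integral_integral_swap hint
    _ = _ := by
        refine integral_congr_ae (ae_of_all _ fun z => ?_)
        simp only
        rw [multiplierKernel_eq_integral, ← integral_const_mul]
        refine integral_congr_ae (ae_of_all _ fun y => ?_)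
        simp only [e]
        ring

theorem enorm_bilinearOp_le {m : ℝ × ℝ → ℂ} {f g : ℝ → ℂ} (hm : Integrable m)
    (hf : Integrable f) (hg : Integrable g) (x : ℝ) :
    ‖bilinearOp m f g x‖ₑ ≤
      ∫⁻ z : ℝ × ℝ, ‖f (x + z.1)‖ₑ * ‖g (x + z.2)‖ₑ * ‖multiplierKernel m z‖ₑ := by
  rw [bilinearOp_eq_integral_kernel hm hf hg]
  refine (enorm_integral_le_lintegral_enorm _).trans (le_of_eq ?_)
  simp only [enorm_mul]

end Kernel

/-! ### Norm bounds for integrable symbols and truncation. -/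

section Bounds

/-- The case of a finite target exponent. -/
theorem eLpNorm_bilinearOp_le_of_ne_top {p q p₁ p₂ p₃ : ℝ≥0∞} (hpq : p.HolderConjugate q)
    (h₁ : 1 ≤ p₁) (h₂ : 1 ≤ p₂) (h₁p : p₁ ≤ p) (h₂p : p₂ ≤ p) (hp : p ≠ ∞) (h₃ : q ≤ p₃)
    (h₃top : p₃ ≠ ∞) (hsum : 1 / p₁ + 1 / p₂ = 1 / p₃ + 2 / p)
    {m : ℝ × ℝ → ℂ} {f g : ℝ → ℂ} (hm : Integrable m)
    (hf : Integrable f) (hg : Integrable g) (hfc : Continuous f) (hgc : Continuous g) :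
    eLpNorm (bilinearOp m f g) p₃ volume ≤
      eLpNorm f p₁ volume * eLpNorm g p₂ volume * eLpNorm (multiplierKernel m) q volume := by
  have hqtop : q ≠ ∞ := ne_top_of_le_ne_top h₃top h₃
  have hreal : p.toReal.HolderConjugate q.toReal :=
    ENNReal.HolderConjugate.toReal_of_ne_top hp hqtop
  have hp0 : p ≠ 0 := (zero_lt_one.trans_le (h₁.trans h₁p)).ne'
  have hq0 : q ≠ 0 := (zero_lt_one.trans_le hpq.symm.one_le).ne'
  have h₁0 : p₁ ≠ 0 := (zero_lt_one.trans_le h₁).ne'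
  have h₂0 : p₂ ≠ 0 := (zero_lt_one.trans_le h₂).ne'
  have h₃0 : p₃ ≠ 0 := (lt_of_lt_of_le (pos_iff_ne_zero.2 hq0) h₃).ne'
  have h₁top : p₁ ≠ ∞ := ne_top_of_le_ne_top hp h₁p
  have h₂top : p₂ ≠ ∞ := ne_top_of_le_ne_top hp h₂p
  have P₁ : 0 < p₁.toReal := ENNReal.toReal_pos h₁0 h₁top
  have P₂ : 0 < p₂.toReal := ENNReal.toReal_pos h₂0 h₂top
  have P₃ : 0 < p₃.toReal := ENNReal.toReal_pos h₃0 h₃top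
  have Q : 0 < q.toReal := ENNReal.toReal_pos hq0 hqtop
  have hsum' : 1 / p₁.toReal + 1 / p₂.toReal = 1 / p₃.toReal + 2 / p.toReal := by
    have := congrArg ENNReal.toReal hsum
    rw [ENNReal.toReal_add (by simp [h₁0]) (by simp [h₂0]),
      ENNReal.toReal_add (by simp [h₃0]) (by simp [ENNReal.div_eq_top, hp0])] at this
    simpa [ENNReal.toReal_div] using this
  have hα : 0 ≤ 1 / p₁.toReal - 1 / p.toReal :=
    sub_nonneg.2 (one_div_le_one_div_of_le P₁ (ENNReal.toReal_mono hp h₁p))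
  have hβ : 0 ≤ 1 / p₂.toReal - 1 / p.toReal :=
    sub_nonneg.2 (one_div_le_one_div_of_le P₂ (ENNReal.toReal_mono hp h₂p))
  -- Taking `F = ‖f‖ ^ p₁` and `α = 1/p₁ - 1/p` gives `F ^ (1/p + α) = ‖f‖`, and similarly for `g`;
  -- the exponent relation is `α + β = 1/p₃`.
  have key := lintegral_bilinear_average_rpow_le
    (hfc.measurable.enorm.pow_const p₁.toReal) (hgc.measurable.enorm.pow_const p₂.toReal)
    ((continuous_multiplierKernel hm).measurable.enorm.pow_const q.toReal) hreal
    (ENNReal.toReal_mono h₃top h₃) hα hβ (by ring_nf at hsum' ⊢; linarith)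
  simp only [add_sub_cancel, ← ENNReal.rpow_mul, mul_one_div_cancel P₁.ne',
    mul_one_div_cancel P₂.ne', mul_one_div_cancel Q.ne', ENNReal.rpow_one] at key
  rw [eLpNorm_eq_lintegral_rpow_enorm_toReal h₃0 h₃top,
    eLpNorm_eq_lintegral_rpow_enorm_toReal h₁0 h₁top,
    eLpNorm_eq_lintegral_rpow_enorm_toReal h₂0 h₂top,
    eLpNorm_eq_lintegral_rpow_enorm_toReal hq0 hqtop, one_div p₃.toReal,
    ENNReal.rpow_inv_le_iff P₃]
  refine (lintegral_mono fun x => ?_).trans key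
  gcongr
  exact enorm_bilinearOp_le hm hf hg x

theorem eLpNorm_tensor_translate {p : ℝ≥0∞} (hp0 : p ≠ 0) (hp : p ≠ ∞) {f g : ℝ → ℂ}
    (hfc : Continuous f) (hgc : Continuous g) (x : ℝ) :
    eLpNorm (fun z : ℝ × ℝ => f (x + z.1) * g (x + z.2)) p volume =
      eLpNorm f p volume * eLpNorm g p volume := by
  rw [eLpNorm_eq_lintegral_rpow_enorm_toReal hp0 hp, eLpNorm_eq_lintegral_rpow_enorm_toReal hp0 hp,
    eLpNorm_eq_lintegral_rpow_enorm_toReal hp0 hp, ← ENNReal.mul_rpow_of_nonneg _ _ (by positivity)]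
  congr 1
  simp only [enorm_mul, ENNReal.mul_rpow_of_nonneg _ _ ENNReal.toReal_nonneg]
  rw [Measure.volume_eq_prod, lintegral_prod_mul (f := fun u => ‖f (x + u)‖ₑ ^ p.toReal)
    (g := fun v => ‖g (x + v)‖ₑ ^ p.toReal),
    lintegral_add_left_eq_self (fun u => ‖f u‖ₑ ^ p.toReal),
    lintegral_add_left_eq_self (fun u => ‖g u‖ₑ ^ p.toReal)]
  · exact ((hfc.comp (continuous_const_add x)).measurable.enorm.pow_const _).aemeasurable
  · exact ((hgc.comp (continuous_const_add x)).measurable.enorm.pow_const _).aemeasurable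

/-- The case of an infinite target exponent. -/
theorem eLpNorm_top_bilinearOp_le {p q : ℝ≥0∞} (hpq : p.HolderConjugate q) (hp : p ≠ ∞)
    {m : ℝ × ℝ → ℂ} {f g : ℝ → ℂ} (hm : Integrable m)
    (hf : Integrable f) (hg : Integrable g) (hfc : Continuous f) (hgc : Continuous g) :
    eLpNorm (bilinearOp m f g) ∞ volume ≤
      eLpNorm f p volume * eLpNorm g p volume * eLpNorm (multiplierKernel m) q volume := by
  have hp0 : p ≠ 0 := (zero_lt_one.trans_le hpq.one_le).ne'
  rw [eLpNorm_exponent_top]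
  refine eLpNormEssSup_le_of_ae_enorm_bound (ae_of_all _ fun x => ?_)
  rw [← eLpNorm_tensor_translate hp0 hp hfc hgc x]
  have hfg : Continuous fun z : ℝ × ℝ => f (x + z.1) * g (x + z.2) := by fun_prop
  have := eLpNorm_smul_le_mul_eLpNorm (p := p) (q := q) (r := 1) (μ := volume)
    (continuous_multiplierKernel hm).aestronglyMeasurable hfg.aestronglyMeasurable
  refine le_trans ?_ this
  rw [eLpNorm_one_eq_lintegral_enorm]
  refine (enorm_bilinearOp_le hm hf hg x).trans (le_of_eq ?_)
  simp [enorm_mul]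

/-- Each inverse is at least `1/p`, so neither can exceed it; `p ≠ 0` keeps `1/p` finite and hence
cancellable. -/
theorem eq_of_sum_inv_eq {p p₁ p₂ : ℝ≥0∞} (hp0 : p ≠ 0)
    (h₁p : p₁ ≤ p) (h₂p : p₂ ≤ p) (hsum : 1 / p₁ + 1 / p₂ = 2 / p) : p₁ = p ∧ p₂ = p := by
  have i₁ : p⁻¹ ≤ p₁⁻¹ := ENNReal.inv_le_inv.2 h₁p
  have i₂ : p⁻¹ ≤ p₂⁻¹ := ENNReal.inv_le_inv.2 h₂p
  have ht : p⁻¹ ≠ ∞ := ENNReal.inv_ne_top.2 hp0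
  have hs : p₁⁻¹ + p₂⁻¹ = p⁻¹ + p⁻¹ := by
    simpa [div_eq_mul_inv, two_mul] using hsum
  constructor
  · refine inv_injective (le_antisymm ?_ i₁)
    refine (ENNReal.add_le_add_iff_right ht).1 ?_
    rw [← hs]
    gcongr
  · refine inv_injective (le_antisymm ?_ i₂)
    refine (ENNReal.add_le_add_iff_left ht).1 ?_
    rw [← hs]
    gcongr

theorem eLpNorm_bilinearOp_le {p q p₁ p₂ p₃ : ℝ≥0∞} (hpq : p.HolderConjugate q)
    (h₁ : 1 ≤ p₁) (h₂ : 1 ≤ p₂) (h₁p : p₁ ≤ p) (h₂p : p₂ ≤ p) (hp : p ≠ ∞) (h₃ : q ≤ p₃)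
    (hsum : 1 / p₁ + 1 / p₂ = 1 / p₃ + 2 / p)
    {m : ℝ × ℝ → ℂ} {f g : ℝ → ℂ} (hm : Integrable m)
    (hf : Integrable f) (hg : Integrable g) (hfc : Continuous f) (hgc : Continuous g) :
    eLpNorm (bilinearOp m f g) p₃ volume ≤
      eLpNorm f p₁ volume * eLpNorm g p₂ volume * eLpNorm (multiplierKernel m) q volume := by
  rcases eq_or_ne p₃ ∞ with rfl | h₃top
  · have hp0 : p ≠ 0 := (zero_lt_one.trans_le hpq.one_le).ne'
    obtain ⟨rfl, rfl⟩ := eq_of_sum_inv_eq hp0 h₁p h₂p (by simpa using hsum)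
    exact eLpNorm_top_bilinearOp_le hpq hp hm hf hg hfc hgc
  · exact eLpNorm_bilinearOp_le_of_ne_top hpq h₁ h₂ h₁p h₂p hp h₃ h₃top hsum hm hf hg hfc hgc

/-- On band-limited functions only a bounded part of the symbol matters. -/
theorem exists_bilinearOp_indicator_eq (m : ℝ × ℝ → ℂ) {f g : ℝ → ℂ}
    (hf : HasCompactSupport (𝓕 f)) (hg : HasCompactSupport (𝓕 g)) :
    ∃ s : Set (ℝ × ℝ), IsCompact s ∧ bilinearOp (s.indicator m) f g = bilinearOp m f g := by
  refine ⟨_, hf.prod hg, ?_⟩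
  funext x
  refine integral_congr_ae (ae_of_all _ fun z => ?_)
  by_cases hz : z ∈ tsupport (𝓕 f) ×ˢ tsupport (𝓕 g)
  · simp [hz]
  · rw [Set.mem_prod, not_and_or] at hz
    rcases hz with hz | hz <;> simp [image_eq_zero_of_notMem_tsupport hz]

end Bounds

/-! ### The multiplier theorem for `L^p` symbols. -/

theorem mainTheorem1 (p p' p₁ p₂ p₃ : ℝ≥0∞) (hpp' : p.HolderConjugate p')
    (h₁ : 1 ≤ p₁) (h₂ : 1 ≤ p₂) (h₁p : p₁ ≤ p) (h₂p : p₂ ≤ p) (hp : p ≤ 2)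
    (h₃ : p' ≤ p₃) (hsum : 1 / p₁ + 1 / p₂ = 1 / p₃ + 2 / p)
    (m : ℝ × ℝ → ℂ) (hm : MemLp m p volume) :
    IsBilinearMultiplier m p₁ p₂ p₃ := by
  have hloc : LocallyIntegrable m volume := hm.locallyIntegrable hpp'.one_le
  have hptop : p ≠ ∞ := ne_top_of_le_ne_top (by simp) hp
  obtain ⟨C, hC⟩ := exists_eLpNorm_multiplierKernel_le hpp' hp
  -- The `+ 1` only ensures positivity when `m` vanishes almost everywhere or `C = 0`.
  refine ⟨hloc, C * (eLpNorm m p volume).toNNReal + 1, by positivity, fun f hf g hg => ?_⟩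
  obtain ⟨s, hs, hBs⟩ := exists_bilinearOp_indicator_eq m hf hg
  have hms : Integrable (s.indicator m) :=
    (hloc.integrableOn_isCompact hs).integrable_indicator hs.measurableSet
  calc eLpNorm (bilinearOp m f g) p₃ volume
      = eLpNorm (bilinearOp (s.indicator m) f g) p₃ volume := by rw [hBs]
    _ ≤ eLpNorm f p₁ volume * eLpNorm g p₂ volume *
          eLpNorm (multiplierKernel (s.indicator m)) p' volume :=
        eLpNorm_bilinearOp_le hpp' h₁ h₂ h₁p h₂p hptop h₃ hsum hms f.integrable g.integrable
          f.continuous g.continuous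
    _ ≤ eLpNorm f p₁ volume * eLpNorm g p₂ volume * (C * eLpNorm m p volume) := by
        gcongr
        refine (hC _ hms (hm.indicator hs.measurableSet)).trans ?_
        gcongr
        exact eLpNorm_indicator_le m
    _ ≤ eLpNorm f p₁ volume * eLpNorm g p₂ volume *
          (C * (eLpNorm m p volume).toNNReal + 1 : ℝ≥0) := by
        gcongr
        push_cast
        rw [ENNReal.coe_toNNReal hm.2.ne]
        exact le_self_add
    _ = _ := by ring
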